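/- Let $f\colon\mathbb R^n\to\mathbb R\cup\{+\infty\}$ be lower semicontinuous and let $\Omega\subset\mathbb R^n$ be nonempty and closed, where $\mathbb R^n$ carries the Euclidean norm and $\mathbb S$ is its unit sphere. Assume that $\operatorname{dom} f\cap\Omega$ is unbounded, where $\operatorname{dom} f=\{x: f(x)<+\infty\}$, and that $f$ is bounded from below on $\Omega$, so that $f_*:=\inf_{x\in\Omega}f(x)$ is finite. Let $\mathrm{Sol}:=\{x\in\Omega: f(x)\le f(y)\ \text{for all}\ y\in\Omega\}$ be the solution set of the problem $\min_{x\in\Omega}f(x)$. Notation. For a subset $D$ of a Euclidean space and $a\in D$, let $\widehat N_D(a):=\{v:\limsup_{x\to a,\ x\in D\setminus\{a\}}\langle v,x-a\rangle/\|x-a\|\le 0\}$ be the regular (Fréchet) normal cone, and $\widehat N_D(a):=\emptyset$ for $a\notin D$. Let $\operatorname{epi}f:=\{(x,r)\in\mathbb R^n\times\mathbb R: r\ge f(x)\}$, and let $\Omega^\infty:=\{u:\exists\, t_k\to+\infty,\ x_k\in\Omega,\ x_k/t_k\to u\}$ be the asymptotic cone. For $u\in\mathbb S$ write $x_k\xrightarrow{u}\infty$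 if $\|x_k\|\to\infty$ and $x_k/\|x_k\|\to u$. Put $$N_\Omega(\infty;u):=\{\xi:\exists\, x_k\in\Omega,\ x_k\xrightarrow{u}\infty,\ \xi_k\in\widehat N_\Omega(x_k),\ \xi_k\to\xi\},$$ $$\mathcal N_u:=\{\zeta\in\mathbb R^n\times\mathbb R:\exists\, x_k\xrightarrow{u}\infty,\ r_k\ge f(x_k),\ \zeta_k\in\widehat N_{\operatorname{epi}f}(x_k,r_k),\ \zeta_k\to\zeta\},$$ $$\partial f(\infty;u):=\{\xi:(\xi,-1)\in\mathcal N_u\},\qquad \partial^\infty f(\infty;u):=\{\xi:(\xi,0)\in\mathcal N_u\}.$$ Theorem. Suppose that for every $u\in\Omega^\infty\cap\mathbb S$ $$\partial^\infty f(\infty;u)\cap\bigl(-N_\Omega(\infty;u)\bigr)=\{0\}\qquad\text{and}\qquad 0\notin\partial f(\infty;u)+N_\Omega(\infty;u).$$ Then: (i) $\mathrm{Sol}$ is nonempty and compact; (ii) the problem has a weak sharp minimum at infinity, i.e. there exist $c>0$ and $R>0$ such that $f(x)-f_*\ge c\,\mathrm{dist}(x,\mathrm{Sol})$ for all $x\in\Omega$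 with $\|x\|>R$; (iii) $f$ is coercive on $\Omega$, i.e. $f(x)\to+\infty$ as $\|x\|\to\infty$ with $x\in\Omega$. -/

import Mathlib

open Filter Topology
open scoped Pointwise

/-- The regular (Fréchet) normal cone to `Ω` at `a`: the set of all `v` such that
`limsup ⟪v, x - a⟫ / ‖x - a‖ ≤ 0` as `x → a` with `x ∈ Ω`, `x ≠ a`; it is empty if `a ∉ Ω`.
The upper limit is taken in the extended reals, so it is `-∞` at an isolated point of `Ω`. -/
def regularNormalCone {E : Type*} [NormedAddCommGroup E] [InnerProductSpace ℝ E]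
    (Ω : Set E) (a : E) : Set E :=
  {v | a ∈ Ω ∧
    limsup (fun x : E => ((inner ℝ v (x - a) / ‖x - a‖ : ℝ) : EReal)) (𝓝[Ω \ {a}] a) ≤ 0}

/-- The sequence `x k` tends to infinity in the direction `u`:
`‖x k‖ → ∞` and `x k / ‖x k‖ → u`. -/
def TendstoInftyDir {E : Type*} [NormedAddCommGroup E] [InnerProductSpace ℝ E]
    (x : ℕ → E) (u : E) : Prop :=
  Tendsto (fun k => ‖x k‖) atTop atTop ∧ Tendsto (fun k => ‖x k‖⁻¹ • x k) atTop (𝓝 u)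

/-- The normal cone `N_Ω(∞; u)` to `Ω` in the direction `u` at infinity. -/
def normalConeInfty {E : Type*} [NormedAddCommGroup E] [InnerProductSpace ℝ E]
    (Ω : Set E) (u : E) : Set E :=
  {ξ | ∃ (x : ℕ → E) (η : ℕ → E), (∀ k, x k ∈ Ω) ∧ TendstoInftyDir x u ∧
    (∀ k, η k ∈ regularNormalCone Ω (x k)) ∧ Tendsto η atTop (𝓝 ξ)}

/-- The epigraph of an extended real valued function, as a subset of `E × ℝ` with the Euclidean
(Hilbert) product structure. -/
def epigraph {E : Type*} [NormedAddCommGroup E] [InnerProductSpace ℝ E]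
    (f : E → EReal) : Set (WithLp 2 (E × ℝ)) :=
  {p | f p.fst ≤ (p.snd : EReal)}

/-- The outer limit of the regular normal cones to the epigraph of `f` at `(x, r)`, as `x` tends to
infinity in the direction `u` and `r ≥ f x`. -/
def epiNormalsInfty {E : Type*} [NormedAddCommGroup E] [InnerProductSpace ℝ E]
    (f : E → EReal) (u : E) : Set (WithLp 2 (E × ℝ)) :=
  {ζ | ∃ (x : ℕ → E) (r : ℕ → ℝ) (η : ℕ → WithLp 2 (E × ℝ)), TendstoInftyDir x u ∧
    (∀ k, f (x k) ≤ (r k : EReal)) ∧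
    (∀ k, η k ∈ regularNormalCone (epigraph f) (WithLp.toLp 2 (x k, r k))) ∧
    Tendsto η atTop (𝓝 ζ)}

/-- The limiting subdifferential `∂f(∞; u)` of `f` in the direction `u` at infinity. -/
def subdiffInfty {E : Type*} [NormedAddCommGroup E] [InnerProductSpace ℝ E]
    (f : E → EReal) (u : E) : Set E :=
  {ξ | WithLp.toLp 2 (ξ, (-1 : ℝ)) ∈ epiNormalsInfty f u}

/-- The singular subdifferential `∂^∞ f(∞; u)` of `f` in the direction `u` at infinity. -/
def singularSubdiffInfty {E : Type*} [NormedAddCommGroup E] [InnerProductSpace ℝ E]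
    (f : E → EReal) (u : E) : Set E :=
  {ξ | WithLp.toLp 2 (ξ, (0 : ℝ)) ∈ epiNormalsInfty f u}

/-- The set of global solutions of the problem of minimizing `f` over `Ω`. -/
def solutionSet {E : Type*} (f : E → EReal) (Ω : Set E) : Set E :=
  {x | x ∈ Ω ∧ IsMinOn f Ω x}

/-- The optimal value `f_*` of the problem of minimizing `f` over `Ω`. -/
noncomputable def optimalValue {E : Type*} (f : E → EReal) (Ω : Set E) : EReal :=
  ⨅ x ∈ Ω, f x

/-- The problem of minimizing `f` over `Ω` has a weak sharp minimum at infinity. -/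
def HasWeakSharpMinInfty {E : Type*} [NormedAddCommGroup E] [InnerProductSpace ℝ E]
    (f : E → EReal) (Ω : Set E) : Prop :=
  ∃ c : ℝ, 0 < c ∧ ∃ R : ℝ, 0 < R ∧ ∀ x ∈ Ω \ Metric.closedBall 0 R,
    ((c * Metric.infDist x (solutionSet f Ω) : ℝ) : EReal) ≤ f x - optimalValue f Ω

/-- `f` is coercive on `Ω`: `f x → +∞` as `‖x‖ → ∞` with `x ∈ Ω`. -/
def IsCoerciveOn {E : Type*} [NormedAddCommGroup E] [InnerProductSpace ℝ E]
    (f : E → EReal) (Ω : Set E) : Prop :=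
  Tendsto f (Bornology.cobounded E ⊓ 𝓟 Ω) (𝓝 ⊤)

/-! Everything follows from linear growth: `f x ≥ f_* + c‖x‖` for large `x ∈ Ω`
(`exists_linear_growth`). If growth fails, there are `y k ∈ Ω` going to infinity with `f (y k) < f_*
+ ε‖y k‖` and `ε → 0`. On the ball of radius `‖y k‖ / 2` about `y k`, add to `f` a quadratic centred
at `y k` and decouple the constraint: `f` is evaluated at `x`, membership in `Ω` is asked of `z`,
and `‖x - z‖²` is heavily penalized. The minimizer is interior, so its optimality conditions give a
normal `v` to `Ω` at `z` and a normal `(-(v + p), -1)` to `epi f` above `x`, with `‖p‖ ≤ 4ε`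
(`exists_almost_opposite_normals`). Dividing by `1 + ‖v‖` and extracting a limit contradicts one of
the two hypotheses at infinity, according to whether the last coordinate vanishes
(`false_of_almost_opposite_normals`). -/

/-! ### Proximal normals and directions at infinity. -/

section RegularNormals

variable {E : Type*} [NormedAddCommGroup E] [InnerProductSpace ℝ E]

/-- Every nonnegative multiple of a proximal normal is a regular normal. -/
theorem smul_mem_regularNormalCone_of_inner_le {D : Set E} {a v : E} (ha : a ∈ D) {C : ℝ}
    (h : ∀ᶠ x in 𝓝[D] a, inner ℝ v (x - a) ≤ C * ‖x - a‖ ^ 2) {t : ℝ} (ht : 0 ≤ t) :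
    t • v ∈ regularNormalCone D a := by
  refine ⟨ha, ?_⟩
  rcases (𝓝[D \ {a}] a).eq_or_neBot with hbot | hne
  · rw [hbot, limsup_bot]
    exact bot_le
  have hlim : Tendsto (fun x : E => ((t * C * ‖x - a‖ : ℝ) : EReal)) (𝓝[D \ {a}] a) (𝓝 0) := by
    have hc : Continuous fun x : E => ((t * C * ‖x - a‖ : ℝ) : EReal) :=
      continuous_coe_real_ereal.comp (by fun_prop)
    have := hc.tendsto a
    simp only [sub_self, norm_zero, mul_zero, EReal.coe_zero] at this
    exact this.mono_left nhdsWithin_le_nhds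
  rw [← hlim.limsup_eq]
  refine limsup_le_limsup ?_
  filter_upwards [h.filter_mono (nhdsWithin_mono a Set.sdiff_subset), self_mem_nhdsWithin]
    with x hx hxa
  have hpos : 0 < ‖x - a‖ := norm_pos_iff.2 (sub_ne_zero.2 hxa.2)
  rw [EReal.coe_le_coe_iff, div_le_iff₀ hpos, inner_smul_left]
  calc t * inner ℝ v (x - a) ≤ t * (C * ‖x - a‖ ^ 2) := mul_le_mul_of_nonneg_left hx ht
    _ = t * C * ‖x - a‖ * ‖x - a‖ := by ring

theorem norm_sub_sq_eq_add_inner (x y z : E) :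
    ‖x - z‖ ^ 2 = ‖y - z‖ ^ 2 + 2 * inner ℝ (y - z) (x - y) + ‖x - y‖ ^ 2 := by
  rw [← norm_add_sq_real]
  congr 2
  abel

/-- Nearby sequences tend to infinity in the same direction. -/
theorem TendstoInftyDir.of_norm_sub_le {x z : ℕ → E} {u : E} (hx : TendstoInftyDir x u)
    (hu : ‖u‖ = 1) (B : ℝ) (hxz : ∀ k, ‖x k - z k‖ ≤ B) : TendstoInftyDir z u := by
  obtain ⟨hx1, hx2⟩ := hx
  have hz1 : Tendsto (fun k => ‖z k‖) atTop atTop := by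
    refine tendsto_atTop_mono (fun k => ?_) (tendsto_atTop_add_const_right _ (-B) hx1)
    have := norm_sub_norm_le (x k) (z k)
    linarith [hxz k]
  have hdiff : Tendsto (fun k => ‖x k‖⁻¹ • (z k - x k)) atTop (𝓝 0) := by
    refine squeeze_zero_norm (a := fun k => ‖x k‖⁻¹ * B) (fun k => ?_) ?_
    · rw [norm_smul, norm_inv, norm_norm, norm_sub_rev]
      exact mul_le_mul_of_nonneg_left (hxz k) (by positivity)
    · simpa using hx1.inv_tendsto_atTop.mul_const B
  have hzx : Tendsto (fun k => ‖x k‖⁻¹ • z k) atTop (𝓝 u) := by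
    have := hx2.add hdiff
    simpa [← smul_add] using this
  have hratio := hzx.norm.inv₀ (by simp [hu])
  refine ⟨hz1, ?_⟩
  -- `z k / ‖z k‖` is `z k / ‖x k‖` divided by its own norm, which tends to `‖u‖ = 1`.
  have := hratio.smul hzx
  rw [hu, inv_one, one_smul] at this
  refine this.congr' ?_
  filter_upwards [hx1.eventually_gt_atTop 0] with k hk
  rw [norm_smul, norm_inv, norm_norm, smul_smul]
  congr 1
  field_simp

theorem TendstoInftyDir.mem_asymptoticCone {Ω : Set E} {x : ℕ → E} {u : E}
    (hx : TendstoInftyDir x u) (hΩ : ∀ k, x k ∈ Ω) : u ∈ asymptoticCone ℝ Ω := by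
  have h := hx.1.atTop_smul_nhds_tendsto_asymptoticNhds hx.2
  have h' : ∃ᶠ k in atTop, ‖x k‖ • (‖x k‖⁻¹ • x k) ∈ Ω := by
    refine Eventually.frequently ?_
    filter_upwards [hx.1.eventually_gt_atTop 0] with k hk
    rw [smul_inv_smul₀ hk.ne']
    exact hΩ k
  exact h.frequently h'

end RegularNormals

/-! ### Decoupled penalization and approximate optimality conditions. -/

section Penalization

variable {E : Type*} [NormedAddCommGroup E] [ProperSpace E]

/-- Existence of a minimizer of the decoupled, penalized problem on a ball. -/
theorem exists_penalized_minimizer {f : E → EReal} {Ω : Set E} (hbot : ∀ x, f x ≠ ⊥)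
    (hlsc : LowerSemicontinuous f) (hΩ : IsClosed Ω) {x₀ : E} (hx₀ : x₀ ∈ Ω) {r₀ : ℝ}
    (hr₀ : f x₀ = r₀) {ρ : ℝ} (hρ : 0 ≤ ρ) (a j : ℝ) :
    ∃ x ∈ Metric.closedBall x₀ ρ, ∃ z ∈ Metric.closedBall x₀ ρ ∩ Ω, ∃ s : ℝ, f x = s ∧
      ∀ x' ∈ Metric.closedBall x₀ ρ, ∀ z' ∈ Metric.closedBall x₀ ρ ∩ Ω, ∀ s' : ℝ, f x' ≤ s' →
        s + a * ‖x - x₀‖ ^ 2 + j * ‖x - z‖ ^ 2 ≤ s' + a * ‖x' - x₀‖ ^ 2 + j * ‖x' - z'‖ ^ 2 := by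
  let q : E × E → ℝ := fun p => a * ‖p.1 - x₀‖ ^ 2 + j * ‖p.1 - p.2‖ ^ 2
  have hq : Continuous fun p : E × E => (q p : EReal) :=
    continuous_coe_real_ereal.comp (by fun_prop)
  have hF : LowerSemicontinuous fun p : E × E => f p.1 + (q p : EReal) :=
    (hlsc.comp continuous_fst).add' hq.lowerSemicontinuous fun p =>
      EReal.continuousAt_add (.inr (EReal.coe_ne_bot _)) (.inl (hbot _))
  have hK : IsCompact (Metric.closedBall x₀ ρ ×ˢ (Metric.closedBall x₀ ρ ∩ Ω)) :=
    (isCompact_closedBall x₀ ρ).prod ((isCompact_closedBall x₀ ρ).inter_right hΩ)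
  have hmem : x₀ ∈ Metric.closedBall x₀ ρ := Metric.mem_closedBall_self hρ
  have hne : (Metric.closedBall x₀ ρ ×ˢ (Metric.closedBall x₀ ρ ∩ Ω)).Nonempty :=
    ⟨(x₀, x₀), hmem, hmem, hx₀⟩
  obtain ⟨⟨x, z⟩, ⟨hx, hz⟩, hmin⟩ := LowerSemicontinuousOn.exists_isMinOn
    hne hK (hF.lowerSemicontinuousOn _)
  rw [isMinOn_iff] at hmin
  have hfin : f x ≠ ⊤ := by
    intro htop
    have := hmin (x₀, x₀) ⟨hmem, hmem, hx₀⟩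
    simp only [htop, hr₀, EReal.top_add_coe, top_le_iff, ← EReal.coe_add] at this
    exact EReal.coe_ne_top _ this
  refine ⟨x, hx, z, hz, (f x).toReal, (EReal.coe_toReal hfin (hbot x)).symm, ?_⟩
  intro x' hx' z' hz' s' hs'
  have h1 := (hmin (x', z') ⟨hx', hz'⟩).trans (add_le_add_left hs' _)
  rw [← EReal.coe_toReal hfin (hbot x)] at h1
  have h2 : (f x).toReal + q (x, z) ≤ s' + q (x', z') := by exact_mod_cast h1
  simp only [q] at h2
  linarith

/-- For a large penalty, a minimizer of the penalized problem lies in the open ball. -/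
theorem exists_interior_penalized_minimizer {f : E → EReal} {Ω : Set E} (hbot : ∀ x, f x ≠ ⊥)
    (hlsc : LowerSemicontinuous f) (hΩ : IsClosed Ω) {x₀ : E} (hx₀ : x₀ ∈ Ω) {r₀ : ℝ}
    (hr₀ : f x₀ = r₀) {ρ : ℝ} (hρ : 0 ≤ ρ) {a : ℝ} (ha : 0 ≤ a)
    (hsphere : ∀ w ∈ Ω, ‖w - x₀‖ = ρ → ((r₀ - a * ρ ^ 2 : ℝ) : EReal) < f w) {δ : ℝ}
    (hδ : 0 < δ) :
    ∃ x ∈ Metric.ball x₀ ρ, ∃ z ∈ Metric.ball x₀ ρ ∩ Ω, ∃ s j : ℝ, f x = s ∧ ‖x - z‖ < δ ∧ 0 < j ∧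
      ∀ x' ∈ Metric.closedBall x₀ ρ, ∀ z' ∈ Metric.closedBall x₀ ρ ∩ Ω, ∀ s' : ℝ, f x' ≤ s' →
        s + a * ‖x - x₀‖ ^ 2 + j * ‖x - z‖ ^ 2 ≤ s' + a * ‖x' - x₀‖ ^ 2 + j * ‖x' - z'‖ ^ 2 := by
  have hmem : x₀ ∈ Metric.closedBall x₀ ρ := Metric.mem_closedBall_self hρ
  choose x hx z hz s hs hmin using fun k : ℕ =>
    exists_penalized_minimizer hbot hlsc hΩ hx₀ hr₀ hρ a ((k : ℝ) + 1)
  obtain ⟨y, -, hy⟩ := LowerSemicontinuousOn.exists_isMinOn ⟨x₀, hmem⟩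
    (isCompact_closedBall x₀ ρ) (hlsc.lowerSemicontinuousOn _)
  rw [isMinOn_iff] at hy
  have hytop : f y ≠ ⊤ := by
    intro h
    have := hy x₀ hmem
    rw [h, hr₀, top_le_iff] at this
    exact EReal.coe_ne_top _ this
  have hb : ∀ k, (f y).toReal ≤ s k := fun k => by
    have := hy (x k) (hx k)
    rw [hs k, ← EReal.coe_toReal hytop (hbot y)] at this
    exact_mod_cast this
  have hval : ∀ k, s k + a * ‖x k - x₀‖ ^ 2 + ((k : ℝ) + 1) * ‖x k - z k‖ ^ 2 ≤ r₀ := fun k => by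
    simpa using hmin k x₀ hmem x₀ ⟨hmem, hx₀⟩ r₀ hr₀.le
  -- Comparison with `(x₀, x₀)` bounds `(k + 1)‖x k - z k‖²` by `r₀` minus the minimum of `f` on the
  -- ball.
  have hgap : Tendsto (fun k => x k - z k) atTop (𝓝 0) := by
    rw [tendsto_zero_iff_norm_tendsto_zero]
    have hinv := (tendsto_one_div_add_atTop_nhds_zero_nat (𝕜 := ℝ)).const_mul (r₀ - (f y).toReal)
    rw [mul_zero] at hinv
    have hsq : Tendsto (fun k => ‖x k - z k‖ ^ 2) atTop (𝓝 0) := by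
      refine squeeze_zero (g := fun k : ℕ => (r₀ - (f y).toReal) * (1 / ((k : ℝ) + 1)))
        (fun k => by positivity) (fun k => ?_) hinv
      rw [mul_one_div, le_div_iff₀ (by positivity)]
      have : 0 ≤ a * ‖x k - x₀‖ ^ 2 := by positivity
      linarith [hval k, hb k]
    simpa using hsq.sqrt
  obtain ⟨w, hw, φ, hφ, hxw⟩ := (isCompact_closedBall x₀ ρ).tendsto_subseq hx
  have hzw : Tendsto (z ∘ φ) atTop (𝓝 w) := by
    have := hxw.sub (hgap.comp hφ.tendsto_atTop)
    simpa [Function.comp_def] using this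
  have hwΩ : w ∈ Ω := hΩ.mem_of_tendsto hzw (Eventually.of_forall fun k => (hz (φ k)).2)
  -- The common limit `w` of `x` and `z` lies in `Ω` and inherits the bound by lower semicontinuity;
  -- `hsphere` then keeps it off the sphere.
  have hfw : f w ≤ ((r₀ - a * ‖w - x₀‖ ^ 2 : ℝ) : EReal) := by
    by_contra! hlt
    obtain ⟨c, hc1, hc2⟩ := EReal.lt_iff_exists_real_btwn.1 hlt
    have hlim : Tendsto (fun k => r₀ - a * ‖x (φ k) - x₀‖ ^ 2) atTop
        (𝓝 (r₀ - a * ‖w - x₀‖ ^ 2)) :=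
      tendsto_const_nhds.sub (((hxw.sub_const x₀).norm.pow 2).const_mul a)
    have : c ≤ r₀ - a * ‖w - x₀‖ ^ 2 := by
      refine ge_of_tendsto hlim ?_
      filter_upwards [hxw.eventually (hlsc w c hc2)] with k hk
      simp only [Function.comp_apply, hs] at hk
      have h1 : c < s (φ k) := by exact_mod_cast hk
      have h2 : 0 ≤ ((φ k : ℝ) + 1) * ‖x (φ k) - z (φ k)‖ ^ 2 := by positivity
      linarith [hval (φ k)]
    exact absurd (EReal.coe_lt_coe_iff.1 hc1) this.not_gt
  have hwball : w ∈ Metric.ball x₀ ρ := by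
    rw [Metric.mem_closedBall] at hw
    refine lt_of_le_of_ne hw fun h => ?_
    rw [dist_eq_norm] at h
    have := hsphere w hwΩ h
    rw [← h] at this
    exact absurd hfw this.not_ge
  obtain ⟨k, hk1, hk2, hk3⟩ := ((hxw.eventually (Metric.isOpen_ball.mem_nhds hwball)).and
    ((hzw.eventually (Metric.isOpen_ball.mem_nhds hwball)).and
      ((hgap.comp hφ.tendsto_atTop).norm.eventually (gt_mem_nhds (by simpa using hδ))))).exists
  exact ⟨x (φ k), hk1, z (φ k), ⟨hk2, (hz _).2⟩, s (φ k), (φ k : ℝ) + 1, hs _, hk3, by positivity,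
    hmin (φ k)⟩

/-- An almost minimizer `x₀` of `f` on `Ω` yields nearby regular normals to `epi f` and to `Ω` that
almost cancel. -/
theorem exists_almost_opposite_normals [InnerProductSpace ℝ E] {f : E → EReal} {Ω : Set E}
    (hbot : ∀ x, f x ≠ ⊥) (hlsc : LowerSemicontinuous f) (hΩ : IsClosed Ω) {m : ℝ}
    (hm : ∀ x ∈ Ω, (m : EReal) ≤ f x) {x₀ : E} (hx₀ : x₀ ∈ Ω) (hne : x₀ ≠ 0) {ε : ℝ} (hε : 0 < ε)
    (hlt : f x₀ < ((m + ε * ‖x₀‖ : ℝ) : EReal)) :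
    ∃ (x z v p : E) (s : ℝ), z ∈ Ω ∧ ‖x - x₀‖ ≤ ‖x₀‖ / 2 ∧ ‖x - z‖ ≤ 1 ∧ ‖p‖ ≤ 4 * ε ∧
      f x ≤ (s : EReal) ∧ (∀ t : ℝ, 0 ≤ t → t • v ∈ regularNormalCone Ω z) ∧
      ∀ t : ℝ, 0 ≤ t → t • WithLp.toLp 2 (-(v + p), (-1 : ℝ)) ∈
        regularNormalCone (epigraph f) (WithLp.toLp 2 (x, s)) := by
  have hpos : 0 < ‖x₀‖ := norm_pos_iff.2 hne
  obtain ⟨r₀, hr₀⟩ : ∃ r₀ : ℝ, f x₀ = r₀ :=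
    ⟨(f x₀).toReal, (EReal.coe_toReal (hlt.trans (EReal.coe_lt_top _)).ne (hbot x₀)).symm⟩
  rw [hr₀, EReal.coe_lt_coe_iff] at hlt
  -- With `ρ = ‖x₀‖ / 2`, this makes `a * ρ ^ 2 = ε * ‖x₀‖`, which exceeds `r₀ - m`, while the
  -- gradient bound `2 * a * ρ` is only `4 * ε`.
  set a : ℝ := 4 * ε / ‖x₀‖ with ha_def
  have ha : 0 < a := by positivity
  have haρ : a * ‖x₀‖ = 4 * ε := by rw [ha_def]; field_simp
  have hsphere : ∀ w ∈ Ω, ‖w - x₀‖ = ‖x₀‖ / 2 →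
      ((r₀ - a * (‖x₀‖ / 2) ^ 2 : ℝ) : EReal) < f w := by
    intro w hw _
    refine lt_of_lt_of_le (EReal.coe_lt_coe_iff.2 ?_) (hm w hw)
    have : a * (‖x₀‖ / 2) ^ 2 = ε * ‖x₀‖ := by
      linear_combination (‖x₀‖ / 4) * haρ
    linarith
  obtain ⟨x, hx, z, ⟨hzb, hzΩ⟩, s, j, hs, hxz, hj, hmin⟩ :=
    exists_interior_penalized_minimizer hbot hlsc hΩ hx₀ hr₀ (by positivity) ha.le hsphere one_pos
  have hxc := Metric.ball_subset_closedBall hx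
  have hzc := Metric.ball_subset_closedBall hzb
  have hxn : ‖x - x₀‖ ≤ ‖x₀‖ / 2 := by rwa [Metric.mem_closedBall, dist_eq_norm] at hxc
  refine ⟨x, z, (2 * j) • (x - z), (2 * a) • (x - x₀), s, hzΩ, hxn, hxz.le, ?_, hs.le, ?_, ?_⟩
  · rw [norm_smul, Real.norm_of_nonneg (by positivity)]
    calc 2 * a * ‖x - x₀‖ ≤ 2 * a * (‖x₀‖ / 2) := mul_le_mul_of_nonneg_left hxn (by positivity)
      _ = 4 * ε := by linear_combination haρ
  · intro t ht
    refine smul_mem_regularNormalCone_of_inner_le hzΩ (C := j) ?_ ht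
    filter_upwards [self_mem_nhdsWithin,
      nhdsWithin_le_nhds (Metric.isOpen_ball.mem_nhds hzb)] with z' hz' hz'b
    -- Vary only `z`: expanding the square gives a proximal inequality with constant `j`.
    have h := hmin x hxc z' ⟨Metric.ball_subset_closedBall hz'b, hz'⟩ s hs.le
    have h2 := norm_sub_sq_eq_add_inner z' z x
    rw [norm_sub_rev z' x, norm_sub_rev z x, ← neg_sub x z, inner_neg_left] at h2
    rw [inner_smul_left, RCLike.conj_to_real]
    rw [h2] at h
    linarith
  · intro t ht
    have hmem : WithLp.toLp 2 (x, s) ∈ epigraph f := hs.le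
    refine smul_mem_regularNormalCone_of_inner_le hmem (C := a + j) ?_ ht
    have hcont : Continuous fun p : WithLp 2 (E × ℝ) => p.fst := by fun_prop
    filter_upwards [self_mem_nhdsWithin, nhdsWithin_le_nhds
      ((Metric.isOpen_ball.preimage hcont).mem_nhds (show WithLp.toLp 2 (x, s) ∈ _ from hx))]
      with p hp hpb
    -- Vary only the point of the epigraph: the two squares contribute `a + j`.
    have h := hmin p.fst (Metric.ball_subset_closedBall hpb) z ⟨hzc, hzΩ⟩ p.snd hp
    rw [norm_sub_sq_eq_add_inner p.fst x x₀, norm_sub_sq_eq_add_inner p.fst x z] at h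
    have hle : ‖p.fst - x‖ ^ 2 ≤ ‖p - WithLp.toLp 2 (x, s)‖ ^ 2 := by
      rw [WithLp.prod_norm_sq_eq_of_L2]
      exact le_add_of_nonneg_right (sq_nonneg ‖(p - WithLp.toLp 2 (x, s)).snd‖)
    have hle' := mul_le_mul_of_nonneg_left hle (add_pos ha hj).le
    refine le_trans ?_ hle'
    simp only [WithLp.prod_inner_apply, WithLp.ofLp_sub, Prod.fst_sub, Prod.snd_sub, inner_neg_left,
      inner_add_left, inner_smul_left, RCLike.conj_to_real]
    simp only [RCLike.inner_apply, conj_trivial]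
    change -(2 * j * inner ℝ (x - z) (p.fst - x) + 2 * a * inner ℝ (x - x₀) (p.fst - x)) +
      -((p.snd - s) * 1) ≤ _
    linarith

end Penalization

/-! ### Passage to the limit and linear growth. -/

section Growth

variable {E : Type*} [NormedAddCommGroup E] [InnerProductSpace ℝ E] [ProperSpace E]

/-- Almost cancelling normals along a sequence tending to infinity violate one of the two conditions
at infinity. -/
theorem false_of_almost_opposite_normals {f : E → EReal} {Ω : Set E}
    (hCQ : ∀ u ∈ asymptoticCone ℝ Ω ∩ Metric.sphere 0 1,
      singularSubdiffInfty f u ∩ (-normalConeInfty Ω u) = {0})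
    (hOpt : ∀ u ∈ asymptoticCone ℝ Ω ∩ Metric.sphere 0 1,
      (0 : E) ∉ subdiffInfty f u + normalConeInfty Ω u)
    {x z v p : ℕ → E} {s : ℕ → ℝ} (hx : Tendsto (fun k => ‖x k‖) atTop atTop)
    (hzΩ : ∀ k, z k ∈ Ω) {B : ℝ} (hxz : ∀ k, ‖x k - z k‖ ≤ B) (hp : Tendsto p atTop (𝓝 0))
    (hs : ∀ k, f (x k) ≤ (s k : EReal))
    (hv : ∀ k, ∀ t : ℝ, 0 ≤ t → t • v k ∈ regularNormalCone Ω (z k))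
    (hepi : ∀ k, ∀ t : ℝ, 0 ≤ t → t • WithLp.toLp 2 (-(v k + p k), (-1 : ℝ)) ∈
      regularNormalCone (epigraph f) (WithLp.toLp 2 (x k, s k))) : False := by
  have hτpos : ∀ k, 0 < (1 + ‖v k‖)⁻¹ := fun k => by positivity
  have hsum : ∀ k, (1 + ‖v k‖)⁻¹ + ‖(1 + ‖v k‖)⁻¹ • v k‖ = 1 := fun k => by
    rw [norm_smul, Real.norm_of_nonneg (hτpos k).le]
    have : (1 + ‖v k‖) ≠ 0 := by positivity
    field_simp
  have hK : IsCompact (Metric.closedBall (0 : E) 1 ×ˢ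
      (Metric.closedBall (0 : E) 1 ×ˢ Set.Icc (0 : ℝ) 1)) :=
    (isCompact_closedBall _ _).prod ((isCompact_closedBall _ _).prod isCompact_Icc)
  obtain ⟨⟨u, w, τ⟩, hmem, φ, hφ, hlim⟩ := hK.tendsto_subseq
    (x := fun k => (‖x k‖⁻¹ • x k, (1 + ‖v k‖)⁻¹ • v k, (1 + ‖v k‖)⁻¹)) fun k => by
      refine ⟨?_, ?_, (hτpos k).le, ?_⟩
      · rw [mem_closedBall_zero_iff, norm_smul, norm_inv, norm_norm]
        exact inv_mul_le_one
      · rw [mem_closedBall_zero_iff]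
        linarith [hsum k, hτpos k]
      · linarith [hsum k, norm_nonneg ((1 + ‖v k‖)⁻¹ • v k)]
  have hτ0 : 0 ≤ τ := hmem.2.2.1
  have hlimu : Tendsto (fun k => ‖x (φ k)‖⁻¹ • x (φ k)) atTop (𝓝 u) :=
    (continuous_fst.tendsto _).comp hlim
  have hlimw : Tendsto (fun k => (1 + ‖v (φ k)‖)⁻¹ • v (φ k)) atTop (𝓝 w) :=
    ((continuous_fst.comp continuous_snd).tendsto _).comp hlim
  have hlimτ : Tendsto (fun k => (1 + ‖v (φ k)‖)⁻¹) atTop (𝓝 τ) :=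
    ((continuous_snd.comp continuous_snd).tendsto _).comp hlim
  have hτw : τ + ‖w‖ = 1 := by
    refine tendsto_nhds_unique (hlimτ.add hlimw.norm) ?_
    simp only [hsum]
    exact tendsto_const_nhds
  have hxφ : Tendsto (fun k => ‖x (φ k)‖) atTop atTop := hx.comp hφ.tendsto_atTop
  have hu : ‖u‖ = 1 := by
    refine tendsto_nhds_unique hlimu.norm (tendsto_const_nhds.congr' ?_)
    filter_upwards [hxφ.eventually_gt_atTop 0] with k hk
    rw [norm_smul, norm_inv, norm_norm, inv_mul_cancel₀ hk.ne']
  have hdirx : TendstoInftyDir (fun k => x (φ k)) u := ⟨hxφ, hlimu⟩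
  have hdirz : TendstoInftyDir (fun k => z (φ k)) u := hdirx.of_norm_sub_le hu B fun k => hxz _
  have huΩ : u ∈ asymptoticCone ℝ Ω ∩ Metric.sphere 0 1 :=
    ⟨hdirz.mem_asymptoticCone fun k => hzΩ _, by simpa using hu⟩
  have hN : ∀ c : ℝ, 0 ≤ c → c • w ∈ normalConeInfty Ω u := fun c hc =>
    ⟨fun k => z (φ k), fun k => (c * (1 + ‖v (φ k)‖)⁻¹) • v (φ k), fun k => hzΩ _, hdirz,
      fun k => hv _ _ (mul_nonneg hc (hτpos _).le), by
        simpa only [mul_smul] using hlimw.const_smul c⟩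
  -- The free scale `c` serves both cases below: `c = 1` if `τ = 0`, and `c = τ⁻¹` to make the last
  -- coordinate `-1`.
  have hS : ∀ c : ℝ, 0 ≤ c → WithLp.toLp 2 (-(c • w), -(c * τ)) ∈ epiNormalsInfty f u := by
    intro c hc
    refine ⟨fun k => x (φ k), fun k => s (φ k), fun k => (c * (1 + ‖v (φ k)‖)⁻¹) •
      WithLp.toLp 2 (-(v (φ k) + p (φ k)), (-1 : ℝ)), hdirx, fun k => hs _,
      fun k => hepi _ _ (mul_nonneg hc (hτpos _).le), ?_⟩
    have h1 : Tendsto (fun k => -(c • ((1 + ‖v (φ k)‖)⁻¹ • v (φ k)) +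
        c • ((1 + ‖v (φ k)‖)⁻¹ • p (φ k)))) atTop (𝓝 (-(c • w))) := by
      have := ((hlimw.const_smul c).add
        ((hlimτ.smul (hp.comp hφ.tendsto_atTop)).const_smul c)).neg
      simpa using this
    have h2 : Tendsto (fun k => -(c * (1 + ‖v (φ k)‖)⁻¹)) atTop (𝓝 (-(c * τ))) :=
      (hlimτ.const_mul c).neg
    have h3 := ((WithLp.prod_continuous_toLp 2 E ℝ).tendsto _).comp (h1.prodMk_nhds h2)
    refine h3.congr fun k => ?_
    simp [← WithLp.toLp_smul, mul_smul]
  rcases hτ0.eq_or_lt with rfl | hτ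
  · have hw : -w ∈ singularSubdiffInfty f u ∩ (-normalConeInfty Ω u) :=
      ⟨by simpa [singularSubdiffInfty] using hS 1 zero_le_one, by simpa using hN 1 zero_le_one⟩
    -- Here `w = 0`, against `τ + ‖w‖ = 1`.
    rw [hCQ u huΩ, Set.mem_singleton_iff, neg_eq_zero] at hw
    simp [hw] at hτw
  · refine hOpt u huΩ (Set.mem_add.2 ⟨-(τ⁻¹ • w), ?_, τ⁻¹ • w, hN _ (by positivity), by simp⟩)
    have := hS τ⁻¹ (by positivity)
    rwa [inv_mul_cancel₀ hτ.ne'] at this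

/-- Under the conditions at infinity `f` grows at least linearly on `Ω`. -/
theorem exists_linear_growth {f : E → EReal} {Ω : Set E} (hbot : ∀ x, f x ≠ ⊥)
    (hlsc : LowerSemicontinuous f) (hΩ : IsClosed Ω) {m : ℝ} (hm : ∀ x ∈ Ω, (m : EReal) ≤ f x)
    (hCQ : ∀ u ∈ asymptoticCone ℝ Ω ∩ Metric.sphere 0 1,
      singularSubdiffInfty f u ∩ (-normalConeInfty Ω u) = {0})
    (hOpt : ∀ u ∈ asymptoticCone ℝ Ω ∩ Metric.sphere 0 1,
      (0 : E) ∉ subdiffInfty f u + normalConeInfty Ω u) :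
    ∃ c : ℝ, 0 < c ∧ ∃ R : ℝ, 0 < R ∧ ∀ x ∈ Ω, R < ‖x‖ →
      ((m + c * ‖x‖ : ℝ) : EReal) ≤ f x := by
  by_contra! hcon
  choose y hyΩ hylarge hy using fun k : ℕ =>
    hcon (1 / ((k : ℝ) + 1)) (by positivity) ((k : ℝ) + 1) (by positivity)
  have hy0 : ∀ k, y k ≠ 0 := fun k => norm_pos_iff.1 (lt_trans (by positivity) (hylarge k))
  choose x z v p s hzΩ hxy hxz hp hs hv hepi using fun k : ℕ =>
    exists_almost_opposite_normals hbot hlsc hΩ hm (hyΩ k) (hy0 k)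
      (ε := 1 / ((k : ℝ) + 1)) (by positivity) (hy k)
  refine false_of_almost_opposite_normals hCQ hOpt (p := p) ?_ hzΩ hxz ?_ hs hv hepi
  -- `‖x k‖ ≥ ‖y k‖ / 2`, since `x k` stays within `‖y k‖ / 2` of `y k`.
  · refine tendsto_atTop_mono (f := fun k : ℕ => (k : ℝ) / 2) (fun k => ?_)
      (tendsto_natCast_atTop_atTop.atTop_div_const two_pos)
    have := norm_sub_norm_le (y k) (x k)
    rw [norm_sub_rev] at this
    linarith [hxy k, hylarge k]
  · refine squeeze_zero_norm hp ?_
    simpa using (tendsto_one_div_add_atTop_nhds_zero_nat (𝕜 := ℝ)).const_mul 4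

end Growth

/-! ### Coercivity, existence of minimizers and weak sharpness. -/

section Consequences

variable {E : Type*} [NormedAddCommGroup E] [InnerProductSpace ℝ E]

theorem isCoerciveOn_of_linear_growth {f : E → EReal} {Ω : Set E} {m c R : ℝ} (hc : 0 < c)
    (h : ∀ x ∈ Ω, R < ‖x‖ → ((m + c * ‖x‖ : ℝ) : EReal) ≤ f x) : IsCoerciveOn f Ω := by
  rw [IsCoerciveOn, EReal.tendsto_nhds_top_iff_real]
  intro b
  have hnorm : Tendsto (fun x : E => ‖x‖) (Bornology.cobounded E) atTop :=
    tendsto_norm_cobounded_atTop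
  have h1 : ∀ᶠ x in Bornology.cobounded E ⊓ 𝓟 Ω, max R ((b - m) / c) < ‖x‖ :=
    (hnorm.eventually_gt_atTop _).filter_mono inf_le_left
  have h2 : ∀ᶠ x in Bornology.cobounded E ⊓ 𝓟 Ω, x ∈ Ω :=
    mem_inf_of_right (mem_principal_self Ω)
  filter_upwards [h1, h2] with x hx hxΩ
  refine lt_of_lt_of_le (EReal.coe_lt_coe_iff.2 ?_) (h x hxΩ ((le_max_left _ _).trans_lt hx))
  have := (div_lt_iff₀ hc).1 ((le_max_right R _).trans_lt hx)
  linarith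

theorem IsCoerciveOn.exists_lt_of_lt_norm {f : E → EReal} {Ω : Set E} (h : IsCoerciveOn f Ω)
    (b : ℝ) : ∃ R : ℝ, ∀ x ∈ Ω, R < ‖x‖ → (b : EReal) < f x := by
  have h1 := EReal.tendsto_nhds_top_iff_real.1 h b
  rw [eventually_inf_principal, ← comap_norm_atTop, eventually_comap] at h1
  obtain ⟨R, hR⟩ := eventually_atTop.1 h1
  exact ⟨R, fun x hx hlt => hR ‖x‖ hlt.le x rfl hx⟩

/-- A coercive lower semicontinuous function which is finite somewhere on a closed set has a
nonempty compact set of minimizers there. -/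
theorem IsCoerciveOn.solutionSet_nonempty_and_isCompact [ProperSpace E] {f : E → EReal} {Ω : Set E}
    (h : IsCoerciveOn f Ω) (hlsc : LowerSemicontinuous f) (hΩ : IsClosed Ω) {x₀ : E}
    (hx₀ : x₀ ∈ Ω) (hfx₀ : f x₀ < ⊤) :
    (solutionSet f Ω).Nonempty ∧ IsCompact (solutionSet f Ω) := by
  obtain ⟨b, hb, -⟩ := EReal.lt_iff_exists_real_btwn.1 hfx₀
  obtain ⟨R, hR⟩ := h.exists_lt_of_lt_norm b
  have hsub : ∀ x ∈ Ω, f x ≤ f x₀ → ‖x‖ ≤ R := fun x hx hle => by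
    by_contra! hlt
    exact absurd (hle.trans_lt hb) (hR x hx hlt).not_gt
  have hKc : IsCompact (Metric.closedBall (0 : E) R ∩ Ω) :=
    (isCompact_closedBall _ _).inter_right hΩ
  have hx₀K : x₀ ∈ Metric.closedBall (0 : E) R ∩ Ω :=
    ⟨mem_closedBall_zero_iff.2 (hsub x₀ hx₀ le_rfl), hx₀⟩
  obtain ⟨y, hyK, hy⟩ := LowerSemicontinuousOn.exists_isMinOn ⟨x₀, hx₀K⟩ hKc
    (hlsc.lowerSemicontinuousOn _)
  rw [isMinOn_iff] at hy
  have hyΩ : ∀ x ∈ Ω, f y ≤ f x := fun x hx => by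
    rcases le_total (f x) (f x₀) with hle | hle
    · exact hy x ⟨mem_closedBall_zero_iff.2 (hsub x hx hle), hx⟩
    · exact (hy x₀ hx₀K).trans hle
  refine ⟨⟨y, hyK.2, isMinOn_iff.2 hyΩ⟩, ?_⟩
  -- A sublevel set of a lower semicontinuous function is closed, hence compactness.
  have heq : solutionSet f Ω = (Metric.closedBall (0 : E) R ∩ Ω) ∩ f ⁻¹' Set.Iic (f y) := by
    ext x
    constructor
    · rintro ⟨hxΩ, hx⟩
      rw [isMinOn_iff] at hx
      exact ⟨⟨mem_closedBall_zero_iff.2 (hsub x hxΩ (hx x₀ hx₀)), hxΩ⟩, hx y hyK.2⟩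
    · rintro ⟨⟨-, hxΩ⟩, hx⟩
      exact ⟨hxΩ, isMinOn_iff.2 fun x' hx' => le_trans hx (hyΩ x' hx')⟩
  rw [heq]
  exact hKc.inter_right (hlsc.isClosed_preimage _)

/-- Beyond the norm of one solution, the distance to the solution set is at most `2 * ‖x‖`, so half
the growth constant works. -/
theorem hasWeakSharpMinInfty_of_linear_growth {f : E → EReal} {Ω : Set E} {m c R : ℝ}
    (hc : 0 < c) (hR : 0 < R) (hm : optimalValue f Ω = m) (hne : (solutionSet f Ω).Nonempty)
    (h : ∀ x ∈ Ω, R < ‖x‖ → ((m + c * ‖x‖ : ℝ) : EReal) ≤ f x) : HasWeakSharpMinInfty f Ω := by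
  obtain ⟨y, hy⟩ := hne
  refine ⟨c / 2, half_pos hc, max R ‖y‖, lt_max_of_lt_left hR, ?_⟩
  rintro x ⟨hxΩ, hx⟩
  rw [mem_closedBall_zero_iff, not_le] at hx
  have hdist : Metric.infDist x (solutionSet f Ω) ≤ 2 * ‖x‖ := by
    refine (Metric.infDist_le_dist_of_mem hy).trans ?_
    rw [dist_eq_norm]
    linarith [norm_sub_le x y, (le_max_right R ‖y‖).trans_lt hx]
  rw [hm, EReal.le_sub_iff_add_le (.inl (EReal.coe_ne_bot _)) (.inl (EReal.coe_ne_top _))]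
  refine le_trans ?_ (h x hxΩ ((le_max_left R ‖y‖).trans_lt hx))
  rw [← EReal.coe_add, EReal.coe_le_coe_iff]
  have := mul_le_mul_of_nonneg_left hdist (half_pos hc).le
  linarith

end Consequences

theorem mainTheorem1 (n : ℕ) (f : EuclideanSpace ℝ (Fin n) → EReal)
    (Ω : Set (EuclideanSpace ℝ (Fin n)))
    (hf_bot : ∀ x, f x ≠ ⊥) (hf_lsc : LowerSemicontinuous f)
    (hΩ : IsClosed Ω)
    (hA1 : ¬ Bornology.IsBounded ({x | f x < ⊤} ∩ Ω))
    (hA2 : ∃ m : ℝ, ∀ x ∈ Ω, (m : EReal) ≤ f x)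
    (hCQ : ∀ u ∈ asymptoticCone ℝ Ω ∩ Metric.sphere 0 1,
      singularSubdiffInfty f u ∩ (-normalConeInfty Ω u) = {0})
    (hOpt : ∀ u ∈ asymptoticCone ℝ Ω ∩ Metric.sphere 0 1,
      (0 : EuclideanSpace ℝ (Fin n)) ∉ subdiffInfty f u + normalConeInfty Ω u) :
    ((solutionSet f Ω).Nonempty ∧ IsCompact (solutionSet f Ω)) ∧
      HasWeakSharpMinInfty f Ω ∧ IsCoerciveOn f Ω := by
  obtain ⟨x₀, hfx₀, hx₀⟩ : ({x | f x < ⊤} ∩ Ω).Nonempty := by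
    by_contra hempty
    rw [Set.not_nonempty_iff_eq_empty] at hempty
    exact hA1 (hempty ▸ Bornology.isBounded_empty)
  obtain ⟨b, hb⟩ := hA2
  have htop : optimalValue f Ω ≠ ⊤ := ((iInf₂_le x₀ hx₀).trans_lt hfx₀).ne
  have hbot : optimalValue f Ω ≠ ⊥ :=
    ((EReal.bot_lt_coe b).trans_le (le_iInf₂ hb)).ne'
  have hm : optimalValue f Ω = ((optimalValue f Ω).toReal : EReal) :=
    (EReal.coe_toReal htop hbot).symm
  obtain ⟨c, hc, R, hR, hgrow⟩ := exists_linear_growth hf_bot hf_lsc hΩ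
    (m := (optimalValue f Ω).toReal) (fun x hx => hm ▸ iInf₂_le x hx) hCQ hOpt
  have hcoer := isCoerciveOn_of_linear_growth hc hgrow
  have hsol := hcoer.solutionSet_nonempty_and_isCompact hf_lsc hΩ hx₀ hfx₀
  exact ⟨hsol, hasWeakSharpMinInfty_of_linear_growth hc hR hm hsol.1 hgrow, hcoer⟩
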